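/- All graphs are finite and simple, and the length of a path is its number of edges. There are absolute constants $C$ and $N$ such that the following holds for every $n\ge N$. Let $G$ be a cubic (that is, 3-regular) graph on $n$ vertices, not necessarily connected. Then the edges of $G$ can be coloured red and blue so that: 1. every monochromatic component (a connected component of the spanning subgraph of $G$ formed by all red edges, or of the one formed by all blue edges) is a path of length at most $C\log n$; 2. for every integer $t\ge 1$, the number of red components that are paths of length $t$ and the number of blue components that are paths of length $t$ differ by at most $n^{2/3}$. -/

import Mathlib

/-- The two colours used on the edges. -/
inductive EdgeColour : Type
  | red
  | blue

namespace EdgeColour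

variable {V : Type*} {G : SimpleGraph V}

/-- A monochromatic component of colour `c` is a connected component of the spanning subgraph
formed by all the edges of colour `c`. -/
abbrev MonoComponent (χ : G.EdgeLabeling EdgeColour) (c : EdgeColour) : Type _ :=
  (χ.labelGraph c).ConnectedComponent

/-- The monochromatic component `K` is a path of length `t`, that is, a path with `t` edges
(and `t + 1` vertices). -/
def IsPathOfLength {χ : G.EdgeLabeling EdgeColour} {c : EdgeColour}
    (K : MonoComponent χ c) (t : ℕ) : Prop :=
  Nonempty (K.toSimpleGraph ≃g SimpleGraph.pathGraph (t + 1))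

/-- The number of monochromatic components of colour `c` that are paths of length `t`. -/
noncomputable def numPaths (χ : G.EdgeLabeling EdgeColour) (c : EdgeColour) (t : ℕ) : ℕ :=
  {K : MonoComponent χ c | IsPathOfLength K t}.ncard

end EdgeColour

/-! Take a depth-first spanning forest, in which every edge joins a vertex to an ancestor. Each edge
is coloured by a sign xor a random bit attached to a nearby vertex, arranged (`exists_isAdapted`) so
that for every choice of bits the two edges at a non-root vertex other than its parent edge differ
in colour, and one chosen edge at each root differs from the other two. Monochromatic degrees are
then at most two. Monochromatic cycles are excluded at the top of the back edge from a deepest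
vertex (`exists_degree_le_one`), so all components are paths.

Away from roots, a monochromatic path climbs along parents and then descends, so a long path
contains a long upward one (`path_length_lt`). An upward path with `64 * m` edges depends on at
least `m` distinct bits, hence is monochromatic in a given colour with probability at most `2 ^
(-m)`; logarithmic `m` suffices for a union bound.

For fixed `t`, the difference of the two path counts has mean zero, since complementing all bits
swaps the colours, and changes by at most 128 when one bit flips. Poincaré's inequality on the cube
bounds its variance by `128 ^ 2 * n`, and Chebyshev's inequality at `n ^ (2/3)` gives failure
probability `O(n ^ (-1/3))`. Only `O(log n)` lengths occur, so some choice of bits satisfies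
everything. -/

/-! ### Variance on the discrete cube. -/

section Cube

variable {V : Type*} [DecidableEq V]

/-- Flip the bit at `u`. -/
def flipBit (u : V) (b : V → Bool) : V → Bool := Function.update b u (!b u)

lemma flipBit_flipBit (u : V) (b : V → Bool) : flipBit u (flipBit u b) = b := by
  ext w
  by_cases h : w = u <;> simp [flipBit, h]

lemma flipBit_comm (u w : V) (b : V → Bool) :
    flipBit u (flipBit w b) = flipBit w (flipBit u b) := by
  ext x
  by_cases h : x = u <;> by_cases h' : x = w <;> by_cases h'' : u = w <;>
    simp_all [flipBit, Function.update_apply]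

lemma flipBit_of_ne {u w : V} (b : V → Bool) (h : w ≠ u) : flipBit u b w = b w := by
  simp [flipBit, h]

variable [Fintype V]

lemma sum_flipBit (u : V) (F : (V → Bool) → ℝ) : ∑ b, F (flipBit u b) = ∑ b, F b :=
  Equiv.sum_comp (Function.Involutive.toPerm (flipBit u) (flipBit_flipBit u)) F

/-- Averaging over the coordinates in `S` loses little of the second moment. -/
lemma exists_average (F : (V → Bool) → ℝ) (D : ℝ)
    (hD : ∀ b u, |F (flipBit u b) - F b| ≤ D) (S : Finset V) :
    ∃ A : (V → Bool) → ℝ, (∀ b u, |A (flipBit u b) - A b| ≤ D) ∧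
      (∀ u ∈ S, ∀ b, A (flipBit u b) = A b) ∧ ∑ b, A b = ∑ b, F b ∧
      ∑ b, F b ^ 2 ≤ ∑ b, A b ^ 2 + S.card * (2 ^ Fintype.card V * D ^ 2) := by
  induction S using Finset.induction_on with
  | empty => exact ⟨F, hD, by simp, rfl, by simp⟩
  | insert u S hu ih =>
    obtain ⟨A, hA, hS, hsum, hsq⟩ := ih
    refine ⟨fun b => (A b + A (flipBit u b)) / 2, ?_, ?_, ?_, ?_⟩
    · intro b w
      have h1 := abs_le.1 (hA b w)
      have h2 := abs_le.1 (hA (flipBit u b) w)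
      dsimp only
      rw [flipBit_comm u w, abs_le]
      constructor <;> linarith [h1.1, h1.2, h2.1, h2.2]
    · intro w hw b
      dsimp only
      rcases Finset.mem_insert.1 hw with rfl | hw
      · rw [flipBit_flipBit, add_comm]
      · rw [flipBit_comm u w, hS w hw, hS w hw]
    · rw [← Finset.sum_div, Finset.sum_add_distrib, sum_flipBit u A, hsum]
      ring
    -- Replacing two values by their mean lowers the mean of their squares by the square of half
    -- their difference, which is at most `D ^ 2 / 4`; the cruder `D ^ 2` suffices.
    · have key : ∑ b, A b ^ 2 ≤ ∑ b, ((A b + A (flipBit u b)) / 2) ^ 2 +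
          2 ^ Fintype.card V * D ^ 2 := by
        have e1 : ∑ b, A b ^ 2 = ∑ b, (A b ^ 2 + A (flipBit u b) ^ 2) / 2 := by
          rw [← Finset.sum_div, Finset.sum_add_distrib, sum_flipBit u (fun b => A b ^ 2)]
          ring
        have e2 : (2 : ℝ) ^ Fintype.card V * D ^ 2 = ∑ _b : V → Bool, D ^ 2 := by
          simp
        rw [e1, e2, ← Finset.sum_add_distrib]
        refine Finset.sum_le_sum fun b _ => ?_
        have h := abs_le.1 (hA b u)
        nlinarith [sq_le_sq' h.1 h.2]
      rw [Finset.card_insert_of_notMem hu]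
      push_cast
      linarith

lemma eq_of_flipBit_invariant (A : (V → Bool) → ℝ) (h : ∀ u b, A (flipBit u b) = A b)
    (b b' : V → Bool) : A b = A b' := by
  have key : ∀ S : Finset V, A (fun w => if w ∈ S then b' w else b w) = A b := by
    intro S
    induction S using Finset.induction_on with
    | empty => simp
    | insert u S hu ih =>
      rw [← ih]
      by_cases hb : b' u = b u
      · congr 1
        ext w
        by_cases hw : w = u <;> simp [hw, hu, hb]
      · rw [← h u]
        congr 1
        ext w
        by_cases hw : w = u
        · subst hw
          have : b' w = !b w := by cases h1 : b w <;> cases h2 : b' w <;> simp_all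
          simp [flipBit, hu, this]
        · simp [flipBit_of_ne _ hw, hw]
  simpa using (key Finset.univ).symm

/-- The Poincaré inequality on the cube, for a function of mean zero. -/
theorem sum_sq_le_of_flipBit_lipschitz (F : (V → Bool) → ℝ) (D : ℝ)
    (hD : ∀ b u, |F (flipBit u b) - F b| ≤ D) (h0 : ∑ b, F b = 0) :
    ∑ b, F b ^ 2 ≤ Fintype.card V * (2 ^ Fintype.card V * D ^ 2) := by
  obtain ⟨A, -, hS, hsum, hsq⟩ := exists_average F D hD Finset.univ
  have hc := eq_of_flipBit_invariant A fun u b => hS u (Finset.mem_univ u) b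
  have hA : ∀ b, A b = 0 := by
    intro b
    have : ∑ b', A b' = ∑ _b' : V → Bool, A b := Finset.sum_congr rfl fun b' _ => hc b' b
    rw [hsum, h0] at this
    simpa using this.symm
  simpa [hA] using hsq

/-- The number of points of the cube whose coordinates in `S` are prescribed. -/
lemma card_filter_eq_on (S : Finset V) (a : V → Bool) :
    (Finset.univ.filter fun b : V → Bool => ∀ u ∈ S, b u = a u).card * 2 ^ S.card =
      2 ^ Fintype.card V := by
  induction S using Finset.induction_on with
  | empty => simp
  | insert u S hu ih =>
    rw [Finset.card_insert_of_notMem hu, ← ih, pow_succ']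
    have hsplit : (Finset.univ.filter fun b : V → Bool => ∀ w ∈ S, b w = a w).card =
        2 * (Finset.univ.filter fun b : V → Bool => ∀ w ∈ insert u S, b w = a w).card := by
      rw [← Finset.card_filter_add_card_filter_not (p := fun b => b u = a u), two_mul]
      rw [Finset.filter_filter, Finset.filter_filter]
      congr 1
      · congr 1
        ext b
        simp [and_comm]
      · refine Finset.card_bij' (fun b _ => flipBit u b) (fun b _ => flipBit u b) ?_ ?_ ?_ ?_
        · intro b hb
          simp only [Finset.mem_filter, Finset.mem_univ, true_and, Finset.forall_mem_insert]
            at hb ⊢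
          refine ⟨by cases h1 : b u <;> cases h2 : a u <;> simp_all [flipBit], fun w hw => ?_⟩
          rw [flipBit_of_ne _ (fun h : w = u => hu (h ▸ hw)), hb.1 w hw]
        · intro b hb
          simp only [Finset.mem_filter, Finset.mem_univ, true_and, Finset.forall_mem_insert]
            at hb ⊢
          refine ⟨fun w hw => ?_, by simp [flipBit, hb.1]⟩
          rw [flipBit_of_ne _ (fun h : w = u => hu (h ▸ hw)), hb.2 w hw]
        · intro b _; exact flipBit_flipBit u b
        · intro b _; exact flipBit_flipBit u b
    rw [hsplit]
    ring

end Cube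

/-! ### Recognising path components and their stability under local changes. -/

namespace SimpleGraph

variable {V : Type*}

/-- A connected graph of maximum degree at most two with a vertex of degree at most one is a
path. -/
theorem Connected.exists_iso_pathGraph [Finite V] {H : SimpleGraph V} (hconn : H.Connected)
    (hdeg : ∀ v a b c, H.Adj v a → H.Adj v b → H.Adj v c → a = b ∨ a = c ∨ b = c)
    (u : V) (hu : ∀ a b, H.Adj u a → H.Adj u b → a = b) :
    ∃ t : ℕ, Nonempty (H ≃g pathGraph (t + 1)) := by
  have := Fintype.ofFinite V
  have hprev : ∀ v k, H.dist u v = k + 1 → ∃ w, H.Adj w v ∧ H.dist u w = k := by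
    intro v k hk
    obtain ⟨p, hp⟩ := hconn.exists_walk_length_eq_dist v u
    rw [dist_comm, hk] at hp
    cases p with
    | nil => simp at hp
    | cons h q =>
      rename_i w
      refine ⟨w, h.symm, ?_⟩
      have h1 := dist_le q
      have h2 := h.symm.diff_dist_adj (u := u)
      have h3 : H.dist w u = H.dist u w := dist_comm
      simp only [Walk.length_cons] at hp
      omega
  -- Distance from `u` will be the isomorphism. It is injective because two vertices at distance `k
  -- + 1` share their predecessor by induction, and that predecessor already spends one of its at
  -- most two edges going back (or is `u`, which has only one edge).
  have hinj : ∀ k v w, H.dist u v = k → H.dist u w = k → v = w := by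
    intro k
    induction k with
    | zero =>
      intro v w hv hw
      rw [hconn.dist_eq_zero_iff] at hv hw
      rw [← hv, ← hw]
    | succ k ih =>
      intro v w hv hw
      obtain ⟨v', hv', hvk⟩ := hprev v k hv
      obtain ⟨w', hw', hwk⟩ := hprev w k hw
      obtain rfl := ih v' w' hvk hwk
      cases k with
      | zero =>
        rw [hconn.dist_eq_zero_iff] at hvk
        subst hvk
        exact hu _ _ hv' hw'
      | succ k =>
        obtain ⟨x, hx, hxk⟩ := hprev v' k hvk
        rcases hdeg v' x v w hx.symm hv' hw' with h | h | h
        · subst h; omega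
        · subst h; omega
        · exact h
  obtain ⟨m, -, hm⟩ := Finset.exists_max_image Finset.univ (fun v => H.dist u v)
    ⟨u, Finset.mem_univ u⟩
  have hsurj : ∀ j i, H.dist u m = i + j → ∃ v, H.dist u v = i := by
    intro j
    induction j with
    | zero => intro i hi; exact ⟨m, hi⟩
    | succ j ih =>
      intro i hi
      obtain ⟨v, hv⟩ := ih (i + 1) (by omega)
      obtain ⟨w, -, hw⟩ := hprev v i hv
      exact ⟨w, hw⟩
  refine ⟨H.dist u m, ⟨⟨Equiv.ofBijective
    (fun v => (⟨H.dist u v, Nat.lt_succ_of_le (hm v (Finset.mem_univ v))⟩ :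
      Fin (H.dist u m + 1))) ⟨?_, ?_⟩, ?_⟩⟩⟩
  · intro v w h
    exact hinj _ v w rfl (by simpa using h.symm)
  · intro i
    obtain ⟨v, hv⟩ := hsurj (H.dist u m - i) i (by omega)
    exact ⟨v, Fin.ext hv⟩
  · intro v w
    rw [pathGraph_adj]
    change H.dist u v + 1 = H.dist u w ∨ H.dist u w + 1 = H.dist u v ↔ H.Adj v w
    have aux : ∀ v w, H.dist u v + 1 = H.dist u w → H.Adj v w := by
      intro v w h
      obtain ⟨x, hx, hxk⟩ := hprev w _ h.symm
      rwa [hinj _ v x rfl hxk]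
    constructor
    · rintro (h | h)
      · exact aux v w h
      · exact (aux w v h).symm
    · intro h
      have h1 := h.diff_dist_adj (u := u)
      have h2 : H.dist u w ≠ H.dist u v := fun e => h.ne (hinj _ v w rfl e)
      have h3 := h.symm.diff_dist_adj (u := u)
      omega

/-- The number of components of `H` that are paths with `t` edges. -/
noncomputable def numPathComponents (H : SimpleGraph V) (t : ℕ) : ℕ :=
  {K : H.ConnectedComponent | Nonempty (K.toSimpleGraph ≃g pathGraph (t + 1))}.ncard

/-- A walk starting in `K` uses only edges at vertices outside `S`, where the two graphs agree, so
in either graph it reaches the same vertices. -/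
lemma exists_component_of_agree {H H' : SimpleGraph V} {S : Set V}
    (hS : ∀ x y, x ∉ S → (H.Adj x y ↔ H'.Adj x y)) (K : H.ConnectedComponent)
    (hK : ∀ v ∈ K.supp, v ∉ S) :
    ∃ K' : H'.ConnectedComponent, K'.supp = K.supp ∧
      Nonempty (K'.toSimpleGraph ≃g K.toSimpleGraph) := by
  induction K using ConnectedComponent.ind with | _ v =>
  have hS' : ∀ w, H.Reachable v w → w ∉ S := fun w hw =>
    hK w (ConnectedComponent.sound hw.symm)
  have key : ∀ w, H'.Reachable v w ↔ H.Reachable v w := by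
    intro w
    constructor
    · intro h
      rw [reachable_iff_reflTransGen] at h
      induction h with
      | refl => exact Reachable.refl _
      | tail _ h ih => exact ih.trans ((hS _ _ (hS' _ ih)).2 h).reachable
    · intro h
      rw [reachable_iff_reflTransGen] at h
      induction h with
      | refl => exact Reachable.refl _
      | tail h' h ih =>
        rw [← reachable_iff_reflTransGen] at h'
        exact ih.trans ((hS _ _ (hS' _ h')).1 h).reachable
  have hsupp : (H'.connectedComponentMk v).supp = (H.connectedComponentMk v).supp := by
    ext w
    simp only [ConnectedComponent.mem_supp_iff, ConnectedComponent.eq]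
    rw [reachable_comm, key, reachable_comm]
  refine ⟨H'.connectedComponentMk v, hsupp, ⟨⟨Equiv.setCongr hsupp, ?_⟩⟩⟩
  rintro ⟨a, ha⟩ ⟨b, hb⟩
  have ha' : a ∈ (H.connectedComponentMk v).supp := hsupp ▸ ha
  exact hS a b (hK a ha')

/-- Components avoiding `S` survive with the same support; each of the others contains a vertex of
`S`, so there are at most `S.card` of them. -/
lemma numPathComponents_le_of_agree [Finite V] {H H' : SimpleGraph V} {S : Finset V}
    (hS : ∀ x y, x ∉ S → (H.Adj x y ↔ H'.Adj x y)) (t : ℕ) :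
    H.numPathComponents t ≤ H'.numPathComponents t + S.card := by
  classical
  set P := {K : H.ConnectedComponent | Nonempty (K.toSimpleGraph ≃g pathGraph (t + 1))}
  set P' := {K : H'.ConnectedComponent | Nonempty (K.toSimpleGraph ≃g pathGraph (t + 1))}
  set M := {K : H.ConnectedComponent | ∀ v ∈ K.supp, v ∉ S}
  have h1 : (P \ M).ncard ≤ S.card := by
    have : P \ M ⊆ (H.connectedComponentMk '' (S : Set V)) := by
      rintro K ⟨-, hK⟩
      simp only [M, Set.mem_ofPred_eq, not_forall, not_not] at hK
      obtain ⟨v, hv, hvS⟩ := hK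
      exact ⟨v, hvS, hv⟩
    refine (Set.ncard_le_ncard this (Set.toFinite _)).trans ?_
    refine (Set.ncard_image_le (Set.toFinite _)).trans ?_
    simp
  have h2 : (P ∩ M).ncard ≤ P'.ncard := by
    rw [← Set.ncard_image_of_injective (P ∩ M) ConnectedComponent.supp_injective,
      ← Set.ncard_image_of_injective P' ConnectedComponent.supp_injective]
    refine Set.ncard_le_ncard ?_ (Set.toFinite _)
    rintro _ ⟨K, ⟨⟨hKP⟩, hKM⟩, rfl⟩
    obtain ⟨K', hK', ⟨e⟩⟩ := exists_component_of_agree (S := (S : Set V))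
      (fun x y hx => hS x y (by simpa using hx)) K (fun v hv => by simpa using hKM v hv)
    exact ⟨K', ⟨e.trans hKP⟩, hK'⟩
  have h3 := Set.ncard_inter_add_ncard_sdiff_eq_ncard P M (Set.toFinite _)
  change P.ncard ≤ P'.ncard + _
  omega

end SimpleGraph

/-! ### Depth-first spanning forests. -/

/-- `p` maps every vertex of a rooted spanning forest of `G` to its parent (and the roots to
themselves), and `d` is the depth. -/
structure IsRootedForest {V : Type*} (G : SimpleGraph V) (p : V → V) (d : V → ℕ) : Prop where
  root : ∀ v, p v = v → d v = 0
  adj : ∀ v, p v ≠ v → G.Adj v (p v)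
  depth : ∀ v, p v ≠ v → d (p v) + 1 = d v

namespace IsRootedForest

variable {V : Type*} {G : SimpleGraph V} {p : V → V} {d : V → ℕ}

lemma root_iff (h : IsRootedForest G p d) (v : V) : p v = v ↔ d v = 0 := by
  refine ⟨h.root v, fun hd => ?_⟩
  by_contra hv
  have := h.depth v hv
  omega

lemma depth_iterate (h : IsRootedForest G p d) (v : V) (k : ℕ) : d (p^[k] v) = d v - k := by
  induction k with
  | zero => rfl
  | succ k ih =>
    rw [Function.iterate_succ_apply']
    by_cases hv : p (p^[k] v) = p^[k] v
    · rw [hv]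
      have := h.root _ hv
      omega
    · have := h.depth _ hv
      omega

lemma depth_lt_card [Fintype V] (h : IsRootedForest G p d) (v : V) : d v < Fintype.card V := by
  classical
  have hsub : Finset.range (d v + 1) ⊆ Finset.univ.image d := by
    intro i hi
    rw [Finset.mem_range] at hi
    refine Finset.mem_image.2 ⟨p^[d v - i] v, Finset.mem_univ _, ?_⟩
    rw [h.depth_iterate]
    omega
  have h1 := Finset.card_le_card hsub
  have h2 := Finset.card_image_le (s := Finset.univ) (f := d)
  simp only [Finset.card_range, Finset.card_univ] at h1 h2
  omega

/-- Moving the subtree of `x` below a neighbour `y` that is at least as deep as `x` and lies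
outside that subtree. -/
lemma rehang [Fintype V] (h : IsRootedForest G p d) {x y : V} (hxy : G.Adj x y)
    (hd : d x ≤ d y) (hanc : ∀ k, p^[k] y ≠ x) :
    ∃ p' d', IsRootedForest G p' d' ∧ ∑ v, d v < ∑ v, d' v := by
  classical
  let D : V → Prop := fun v => ∃ k, p^[k] v = x
  have hDx : D x := ⟨0, rfl⟩
  have hDp : ∀ v, D (p v) → D v := fun v ⟨k, hk⟩ => ⟨k + 1, hk⟩
  have hDp' : ∀ v, v ≠ x → D v → D (p v) := by
    rintro v hv ⟨k, hk⟩
    cases k with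
    | zero => exact absurd hk hv
    | succ k => exact ⟨k, hk⟩
  have hDy : ¬ D y := fun ⟨k, hk⟩ => hanc k hk
  -- The truncated subtraction is exact since `d x ≤ d y`. The shift is at least 1, so the total
  -- depth increases strictly.
  refine ⟨Function.update p x y, fun v => if D v then d v + (d y + 1 - d x) else d v,
    ⟨?_, ?_, ?_⟩, ?_⟩
  · intro v hv
    by_cases hvx : v = x
    · subst hvx
      simp only [Function.update_self] at hv
      exact absurd hv hxy.symm.ne
    · rw [Function.update_of_ne hvx] at hv
      have : ¬ D v := by
        rintro ⟨k, hk⟩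
        rw [Function.iterate_fixed hv] at hk
        exact hvx hk
      simp only [this, if_false]
      exact h.root v hv
  · intro v hv
    by_cases hvx : v = x
    · subst hvx
      simpa using hxy
    · rw [Function.update_of_ne hvx] at hv ⊢
      exact h.adj v hv
  · intro v hv
    by_cases hvx : v = x
    · subst hvx
      simp only [Function.update_self, hDy, hDx, if_true, if_false]
      omega
    · rw [Function.update_of_ne hvx] at hv ⊢
      have := h.depth v hv
      by_cases hD : D v
      · simp only [hD, hDp' v hvx hD, if_true]
        omega
      · rw [if_neg hD, if_neg fun h' => hD (hDp v h')]
        exact this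
  · refine Finset.sum_lt_sum (fun v _ => ?_) ⟨x, Finset.mem_univ x, ?_⟩
    · split_ifs <;> omega
    · simp only [hDx, if_true]
      omega

end IsRootedForest

/-- A normal (depth-first search) spanning forest: every edge of `G` joins a vertex to one of
its ancestors. -/
structure IsNormalForest {V : Type*} (G : SimpleGraph V) (p : V → V) (d : V → ℕ) : Prop
    extends IsRootedForest G p d where
  ancestor : ∀ x y, G.Adj x y → d x ≤ d y → ∃ k, p^[k] y = x

/-- An edge violating normality allows a `rehang`, which increases the total depth; but that total
is at most the square of the number of vertices. The process starts from the forest in which every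
vertex is a root. -/
theorem exists_isNormalForest {V : Type*} [Fintype V] (G : SimpleGraph V) :
    ∃ p d, IsNormalForest G p d := by
  by_contra hcon
  push Not at hcon
  have hstep : ∀ N : ℕ, ∃ p d, IsRootedForest G p d ∧ N ≤ ∑ v, d v := by
    intro N
    induction N with
    | zero => exact ⟨id, fun _ => 0, ⟨fun _ _ => rfl, by simp, by simp⟩, by simp⟩
    | succ N ih =>
      obtain ⟨p, d, h, hN⟩ := ih
      have : ¬ ∀ x y, G.Adj x y → d x ≤ d y → ∃ k, p^[k] y = x :=
        fun hanc => hcon p d ⟨h, hanc⟩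
      push Not at this
      obtain ⟨x, y, hxy, hd, hanc⟩ := this
      obtain ⟨p', d', h', hlt⟩ := h.rehang hxy hd hanc
      exact ⟨p', d', h', by omega⟩
  obtain ⟨p, d, h, hN⟩ := hstep (Fintype.card V * Fintype.card V + 1)
  have : ∑ v, d v ≤ _ := Finset.sum_le_card_nsmul Finset.univ d (Fintype.card V)
    fun v _ => (h.depth_lt_card v).le
  simp only [Finset.card_univ, smul_eq_mul] at this
  omega

namespace IsNormalForest

variable {V : Type*} {G : SimpleGraph V} {p : V → V} {d : V → ℕ}

lemma depth_ne (h : IsNormalForest G p d) {x y : V} (hxy : G.Adj x y) : d x ≠ d y := by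
  intro hd
  obtain ⟨k, hk⟩ := h.ancestor x y hxy hd.le
  have h1 := h.depth_iterate y k
  rw [hk] at h1
  cases k with
  | zero => exact hxy.ne hk.symm
  | succ k =>
    have h0 : d y = 0 := by omega
    rw [Function.iterate_fixed ((h.root_iff y).2 h0)] at hk
    exact hxy.ne hk.symm

lemma iterate_of_lt (h : IsNormalForest G p d) {x y : V} (hxy : G.Adj x y) (hd : d x < d y) :
    p^[d y - d x] y = x := by
  obtain ⟨k, hk⟩ := h.ancestor x y hxy hd.le
  have h1 := h.depth_iterate y k
  rw [hk] at h1
  -- Since `p` fixes roots, `k` may overshoot when `x` is a root; the surplus iterations do nothing.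
  rcases Nat.eq_zero_or_pos (d x) with h0 | h0
  · have hx := (h.root_iff x).2 h0
    have hle : d y ≤ k := by omega
    have h2 : p (p^[d y] y) = p^[d y] y := by
      rw [h.root_iff, h.depth_iterate, Nat.sub_self]
    obtain ⟨j, rfl⟩ := Nat.exists_eq_add_of_le hle
    rw [add_comm, Function.iterate_add_apply, Function.iterate_fixed h2] at hk
    rw [h0, Nat.sub_zero, hk]
  · have : d y - d x = k := by omega
    rw [this, hk]

/-- The root of the tree containing `v`. -/
lemma root_eq_of_adj (h : IsNormalForest G p d) {x y : V} (hxy : G.Adj x y) :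
    p^[d x] x = p^[d y] y := by
  wlog hd : d x < d y generalizing x y
  · exact (this hxy.symm (lt_of_le_of_ne (not_lt.1 hd) (h.depth_ne hxy.symm))).symm
  have h1 := h.iterate_of_lt hxy hd
  have h2 : p^[d x] (p^[d y - d x] y) = p^[d y] y := by
    rw [← Function.iterate_add_apply, Nat.add_sub_cancel' hd.le]
  rwa [h1] at h2

end IsNormalForest

/-! ### Signed labels adapted to a normal forest. -/

/-- The colour of the edge `xy` when the bits are `b`: the pair `E x y` consists of a sign and of
the vertex whose bit is used. -/
def signedColour {V : Type*} (E : V → V → Bool × V) (b : V → Bool) (x y : V) : Bool :=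
  xor (E x y).1 (b (E x y).2)

/-- `u` is reached from `x` by at most three steps along edges of `G`. -/
def WithinThree {V : Type*} (G : SimpleGraph V) (x u : V) : Prop :=
  ∃ a c, (x = a ∨ G.Adj x a) ∧ (a = c ∨ G.Adj a c) ∧ (c = u ∨ G.Adj c u)

/-- The signed labels `E` on the edges of `G` are adapted to the normal forest `p`: whatever the
bits are, the two edges from a vertex away from its parent have different colours, and at a root
`r` the edge to its child `f r` has a colour different from the other edges. -/
structure IsAdapted {V : Type*} (G : SimpleGraph V) (p : V → V) (d : V → ℕ)
    (E : V → V → Bool × V) (f : V → V) : Prop where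
  symm : ∀ x y, G.Adj x y → E x y = E y x
  local_label : ∀ x y, G.Adj x y → WithinThree G x (E x y).2
  nonroot : ∀ v a c, p v ≠ v → G.Adj v a → G.Adj v c → a ≠ c → a ≠ p v → c ≠ p v →
    ∀ b, signedColour E b v a ≠ signedColour E b v c
  root : ∀ r a, p r = r → G.Adj r a → a ≠ f r →
    ∀ b, signedColour E b r a ≠ signedColour E b r (f r)
  root_adj : ∀ r, p r = r → G.Adj r (f r) ∧ p (f r) = r
  root_back : ∀ r x, p r = r → G.Adj r x → p x ≠ r →
    ∃ x', G.Adj r x' ∧ p x' ≠ r ∧ p^[d x' - 1] x' = f r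

namespace SimpleGraph

variable {V : Type*} [Fintype V] {G : SimpleGraph V} [DecidableRel G.Adj]

lemma IsRegularOfDegree.exists_adj_ne_ne (hG : G.IsRegularOfDegree 3) (v s t : V) :
    ∃ a, G.Adj v a ∧ a ≠ s ∧ a ≠ t := by
  classical
  by_contra! hcon
  have hsub : G.neighborFinset v ⊆ {s, t} := by
    intro a ha
    rw [mem_neighborFinset] at ha
    by_cases h : a = s
    · simp [h]
    · simp [hcon a ha h]
  have h1 := Finset.card_le_card hsub
  have h2 := Finset.card_le_two (a := s) (b := t)
  have h3 : (G.neighborFinset v).card = 3 := hG v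
  omega

lemma IsRegularOfDegree.eq_or_eq_or_eq (hG : G.IsRegularOfDegree 3) {v a b c e : V}
    (ha : G.Adj v a) (hb : G.Adj v b) (hc : G.Adj v c) (hab : a ≠ b) (hac : a ≠ c)
    (hbc : b ≠ c) (he : G.Adj v e) : e = a ∨ e = b ∨ e = c := by
  classical
  have hsub : ({a, b, c} : Finset V) ⊆ G.neighborFinset v := by
    intro x hx
    simp only [Finset.mem_insert, Finset.mem_singleton] at hx
    rw [mem_neighborFinset]
    rcases hx with rfl | rfl | rfl <;> assumption
  have h3 : (G.neighborFinset v).card = 3 := hG v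
  have heq := Finset.eq_of_subset_of_card_le hsub
    (by rw [h3, Finset.card_eq_three.2 ⟨a, b, c, hab, hac, hbc, rfl⟩])
  have : e ∈ ({a, b, c} : Finset V) := by rw [heq, mem_neighborFinset]; exact he
  simpa using this

end SimpleGraph

namespace IsNormalForest

variable {V : Type*} {G : SimpleGraph V} {p : V → V} {d : V → ℕ}

/-- A descendant `x` of `y` that is a neighbour lies below a child of `y`. -/
lemma child_of_lt (h : IsNormalForest G p d) {x y : V} (hxy : G.Adj y x) (hd : d y < d x) :
    G.Adj y (p^[d x - d y - 1] x) ∧ p (p^[d x - d y - 1] x) = y ∧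
      d (p^[d x - d y - 1] x) = d y + 1 := by
  have h1 := h.iterate_of_lt hxy hd
  obtain ⟨k, hk⟩ : ∃ k, d x - d y = k + 1 := ⟨d x - d y - 1, by omega⟩
  rw [hk, Nat.add_sub_cancel]
  rw [hk, Function.iterate_succ_apply'] at h1
  have h2 := h.depth_iterate x k
  have h3 : p (p^[k] x) ≠ p^[k] x := by
    intro h3
    have := h.root _ h3
    omega
  have h4 := h.adj _ h3
  rw [h1] at h4
  exact ⟨h4.symm, h1, by omega⟩

/-- The choice, at every vertex, of the edge whose sign is positive. -/
lemma exists_first [Fintype V] [DecidableRel G.Adj] (h : IsNormalForest G p d)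
    (hG : G.IsRegularOfDegree 3) :
    ∃ f : V → V, (∀ v, p v ≠ v → G.Adj v (f v) ∧ f v ≠ p v ∧ f v ≠ p^[d v] v) ∧
      (∀ r, p r = r → G.Adj r (f r) ∧ p (f r) = r) ∧
      ∀ r x, p r = r → G.Adj r x → p x ≠ r →
        ∃ x', G.Adj r x' ∧ p x' ≠ r ∧ p^[d x' - 1] x' = f r := by
  have hroot : ∀ r x, p r = r → G.Adj r x →
      G.Adj r (p^[d x - 1] x) ∧ p (p^[d x - 1] x) = r := by
    intro r x hr hx
    have h0 := h.root r hr
    have hne := h.depth_ne hx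
    have := h.child_of_lt hx (by omega)
    rw [h0, Nat.sub_zero] at this
    exact ⟨this.1, this.2.1⟩
  have key : ∀ v, ∃ w, (p v ≠ v → G.Adj v w ∧ w ≠ p v ∧ w ≠ p^[d v] v) ∧
      (p v = v → (G.Adj v w ∧ p w = v) ∧
        ∀ x, G.Adj v x → p x ≠ v → ∃ x', G.Adj v x' ∧ p x' ≠ v ∧ p^[d x' - 1] x' = w) := by
    intro v
    by_cases hv : p v = v
    -- At a root with a back edge, the chosen child is the one on the tree path to the lower end of
    -- some back edge; this later rules out a monochromatic cycle through the root.
    · by_cases hx : ∃ x, G.Adj v x ∧ p x ≠ v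
      · obtain ⟨x, hx, hpx⟩ := hx
        exact ⟨p^[d x - 1] x, fun hn => absurd hv hn,
          fun _ => ⟨hroot v x hv hx, fun _ _ _ => ⟨x, hx, hpx, rfl⟩⟩⟩
      · obtain ⟨x, hadj, -⟩ := hG.exists_adj_ne_ne v v v
        exact ⟨p^[d x - 1] x, fun hn => absurd hv hn,
          fun _ => ⟨hroot v x hv hadj, fun y hy hpy => absurd ⟨y, hy, hpy⟩ hx⟩⟩
    -- Avoiding the root `p^[d v] v` makes every back edge to a root carry the negative sign.
    · obtain ⟨w, hw⟩ := hG.exists_adj_ne_ne v (p v) (p^[d v] v)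
      exact ⟨w, fun _ => hw, fun hn => absurd hn hv⟩
  choose f hf using key
  exact ⟨f, fun v hv => (hf v).1 hv, fun r hr => ((hf r).2 hr).1,
    fun r x hr => ((hf r).2 hr).2 x⟩

/-- A back edge takes its label from its lower end. A tree edge takes it from its upper end `y`,
except when `y` is a non-root receiving a back edge from below: then it takes the opposite of that
label. Since `y` has only two edges away from its parent, these are then the back edge and the tree
edge towards its lower end. -/
theorem exists_isAdapted [Fintype V] [DecidableRel G.Adj] (h : IsNormalForest G p d)
    (hG : G.IsRegularOfDegree 3) : ∃ E f, IsAdapted G p d E f := by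
  classical
  obtain ⟨f, hf, hfr, hfb⟩ := h.exists_first hG
  -- The bit governing `x` is its own, unless `x` sends a back edge to its root: then it is the
  -- root's bit, so that all edges at a root share one bit.
  let σ : V → V := fun x => if G.Adj x (p^[d x] x) ∧ p x ≠ p^[d x] x then p^[d x] x else x
  let down : V → V → Prop := fun y z => G.Adj y z ∧ d y < d z ∧ p z ≠ y
  let U : V → V → Bool × V := fun x y =>
    if p x ≠ y then (decide (y = f x), σ x)
    else if hz : p y ≠ y ∧ ∃ z, down y z then (!decide (y = f hz.2.choose), σ hz.2.choose)
    else (decide (x = f y), σ y)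
  let E : V → V → Bool × V := fun x y => if d y < d x then U x y else U y x
  have hσ : ∀ x, x = σ x ∨ G.Adj x (σ x) := by
    intro x
    by_cases hx : G.Adj x (p^[d x] x) ∧ p x ≠ p^[d x] x
    · right
      simp only [σ, if_pos hx]
      exact hx.1
    · left
      simp only [σ, if_neg hx]
  have hU : ∀ x y, G.Adj x y → WithinThree G x (U x y).2 ∧ WithinThree G y (U x y).2 := by
    intro x y hxy
    by_cases h1 : p x ≠ y
    · simp only [U, if_pos h1]
      exact ⟨⟨x, x, .inl rfl, .inl rfl, hσ x⟩, ⟨x, x, .inr hxy.symm, .inl rfl, hσ x⟩⟩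
    · by_cases hz : p y ≠ y ∧ ∃ z, down y z
      · simp only [U, if_neg h1, dif_pos hz]
        have hd := hz.2.choose_spec
        exact ⟨⟨y, _, .inr hxy, .inr hd.1, hσ _⟩, ⟨y, _, .inl rfl, .inr hd.1, hσ _⟩⟩
      · simp only [U, if_neg h1, dif_neg hz]
        exact ⟨⟨y, y, .inr hxy, .inl rfl, hσ y⟩, ⟨y, y, .inl rfl, .inl rfl, hσ y⟩⟩
  have hE₁ : ∀ x y, d y < d x → E x y = U x y := fun x y hd => if_pos hd
  have hE₂ : ∀ x y, d x < d y → E x y = U y x := fun x y hd => if_neg (by omega)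
  refine ⟨E, f, ⟨?_, ?_, ?_, ?_, hfr, hfb⟩⟩
  · intro x y hxy
    rcases lt_or_gt_of_ne (h.depth_ne hxy) with hd | hd
    · rw [hE₂ x y hd, hE₁ y x hd]
    · rw [hE₁ x y hd, hE₂ y x hd]
  · intro x y hxy
    rcases lt_or_gt_of_ne (h.depth_ne hxy) with hd | hd
    · rw [hE₂ x y hd]
      exact (hU y x hxy.symm).2
    · rw [hE₁ x y hd]
      exact (hU x y hxy).1
  · intro v a c hv ha hc hac hap hcp b
    have hcover : ∀ e, G.Adj v e → e ≠ p v → e = a ∨ e = c := by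
      intro e he hep
      rcases hG.eq_or_eq_or_eq (h.adj v hv) ha hc hap.symm hcp.symm hac he with h' | h' | h'
      · exact absurd h' hep
      · exact .inl h'
      · exact .inr h'
    have hpv := h.depth v hv
    have hdiff : ∀ x y, G.Adj v x → x ≠ p v → G.Adj v y → y ≠ p v → x ≠ y →
        signedColour E b v x ≠ signedColour E b v y →
        signedColour E b v a ≠ signedColour E b v c := by
      intro x y hx hxp hy hyp hxy hcol
      rcases hcover x hx hxp with rfl | rfl <;> rcases hcover y hy hyp with rfl | rfl
      · exact absurd rfl hxy
      · exact hcol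
      · exact hcol.symm
      · exact absurd rfl hxy
    -- Either the two edges are a back edge from below and the tree edge carrying its negated label,
    -- or both use the bit `σ v` and exactly one is `f v`.
    by_cases hz : p v ≠ v ∧ ∃ z, down v z
    · have hzs := hz.2.choose_spec
      set z := hz.2.choose with hzdef
      obtain ⟨hzadj, hzd, hzp⟩ := hzs
      obtain ⟨hq1, hq2, hq3⟩ := h.child_of_lt hzadj hzd
      set q := p^[d z - d v - 1] z
      refine hdiff z q hzadj (fun e => ?_) hq1 (fun e => ?_) (fun e => ?_) ?_
      · rw [e] at hzd; omega
      · rw [e] at hq3; omega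
      · exact hzp (e ▸ hq2)
      · have e1 : E v z = (decide (v = f z), σ z) := by
          rw [hE₂ v z hzd]
          exact if_pos hzp
        have e2 : E v q = (!decide (v = f z), σ z) := by
          rw [hE₂ v q (by omega)]
          simp only [U]
          rw [if_neg (not_not.2 hq2), dif_pos hz]
        simp only [signedColour, e1, e2]
        cases decide (v = f z) <;> cases b (σ z) <;> simp
    · have hlab : ∀ e, G.Adj v e → e ≠ p v → E v e = (decide (e = f v), σ v) := by
        intro e he hep
        rcases lt_or_gt_of_ne (h.depth_ne he) with hd | hd
        · have hpe : p e = v := by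
            by_contra hpe
            exact hz ⟨hv, e, he, hd, hpe⟩
          rw [hE₂ v e hd]
          simp only [U]
          rw [if_neg (not_not.2 hpe), dif_neg hz]
        · rw [hE₁ v e hd]
          exact if_pos hep.symm
      obtain ⟨hf1, hf2, -⟩ := hf v hv
      obtain ⟨g, hg1, hg2, hg3⟩ := hG.exists_adj_ne_ne v (p v) (f v)
      refine hdiff (f v) g hf1 hf2 hg1 hg2 hg3.symm ?_
      simp only [signedColour, hlab _ hf1 hf2, hlab _ hg1 hg2, hg3]
      cases b (σ v) <;> simp
  · intro r a hr ha har b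
    have hr0 := h.root r hr
    have hdr : ∀ x, G.Adj r x → d r < d x := by
      intro x hx
      have := h.depth_ne hx
      omega
    have hσr : σ r = r := by
      simp [σ, hr0]
    have hchild : ∀ x, G.Adj r x → p x = r → E r x = (decide (x = f r), r) := by
      intro x hx hpx
      rw [hE₂ r x (hdr x hx)]
      simp only [U]
      rw [if_neg (not_not.2 hpx), dif_neg (fun hz => hz.1 hr), hσr]
    have hother : E r a = (false, r) := by
      by_cases hpa : p a = r
      · rw [hchild a ha hpa]
        simp [har]
      · have hra := h.iterate_of_lt ha (hdr a ha)
        rw [hr0, Nat.sub_zero] at hra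
        have hanr : p a ≠ a := by
          intro hpa'
          have := h.root a hpa'
          have := hdr a ha
          omega
        have hfa := (hf a hanr).2.2
        rw [hra] at hfa
        rw [hE₂ r a (hdr a ha)]
        simp only [U, σ]
        rw [if_pos hpa, hra, if_pos ⟨ha.symm, hpa⟩]
        simp [hfa.symm]
    obtain ⟨h1, h2⟩ := hfr r hr
    simp [signedColour, hother, hchild _ h1 h2]

end IsNormalForest

/-! ### Monochromatic components: they are paths, with controlled length. -/

/-- The properties of the monochromatic graphs of a colouring adapted to a normal forest. -/
structure IsTame {V : Type*} (G : SimpleGraph V) (p f : V → V) (H : SimpleGraph V) : Prop where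
  le : H ≤ G
  nonroot : ∀ v a c, p v ≠ v → H.Adj v a → H.Adj v c → a ≠ c → a = p v ∨ c = p v
  root : ∀ r a c, p r = r → H.Adj r a → H.Adj r c → a ≠ c → a ≠ f r

lemma IsAdapted.isTame {V : Type*} {G : SimpleGraph V} {p : V → V} {d : V → ℕ}
    {E : V → V → Bool × V} {f : V → V} (hA : IsAdapted G p d E f) {H : SimpleGraph V}
    {b : V → Bool} {c : Bool} (hH : ∀ x y, H.Adj x y ↔ G.Adj x y ∧ signedColour E b x y = c) :
    IsTame G p f H where
  le := fun x y h => ((hH x y).1 h).1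
  nonroot := by
    intro v x y hv hx hy hxy
    by_contra! hcon
    rw [hH] at hx hy
    exact hA.nonroot v x y hv hx.1 hy.1 hxy hcon.1 hcon.2 b (hx.2.trans hy.2.symm)
  root := by
    rintro r x y hr hx hy hxy rfl
    rw [hH] at hx hy
    exact hA.root r y hr hy.1 hxy.symm b (hy.2.trans hx.2.symm)

namespace IsTame

open SimpleGraph

variable {V : Type*} {G H : SimpleGraph V} {p f : V → V} {d : V → ℕ} {E : V → V → Bool × V}

section Component

variable [Fintype V] [DecidableRel G.Adj]

lemma degree_le_two (hH : IsTame G p f H) (hG : G.IsRegularOfDegree 3)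
    (hA : IsAdapted G p d E f) (v a b c : V) (ha : H.Adj v a) (hb : H.Adj v b)
    (hc : H.Adj v c) : a = b ∨ a = c ∨ b = c := by
  by_contra! hcon
  obtain ⟨hab, hac, hbc⟩ := hcon
  by_cases hv : p v = v
  · have h1 := hH.root v a b hv ha hb hab
    have h2 := hH.root v b a hv hb ha hab.symm
    have h3 := hH.root v c a hv hc ha hac.symm
    rcases hG.eq_or_eq_or_eq (hH.le ha) (hH.le hb) (hH.le hc) hab hac hbc
      (hA.root_adj v hv).1 with h | h | h
    · exact h1 h.symm
    · exact h2 h.symm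
    · exact h3 h.symm
  · have h1 := hH.nonroot v a b hv ha hb hab
    have h2 := hH.nonroot v a c hv ha hc hac
    have h3 := hH.nonroot v b c hv hb hc hbc
    grind

/-- No component consists of vertices of degree two. -/
lemma exists_degree_le_one (hH : IsTame G p f H) (hG : G.IsRegularOfDegree 3)
    (hF : IsNormalForest G p d) (hA : IsAdapted G p d E f) (K : H.ConnectedComponent) :
    ∃ u ∈ K.supp, ∀ a b, H.Adj u a → H.Adj u b → a = b := by
  by_contra! hcon
  have hclosed : ∀ v w, v ∈ K.supp → H.Adj v w → w ∈ K.supp := fun v w hv hvw =>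
    (K.mem_supp_congr_adj hvw).1 hv
  have hparent : ∀ v ∈ K.supp, p v ≠ v → H.Adj v (p v) := by
    intro v hv hpv
    obtain ⟨a, b, ha, hb, hab⟩ := hcon v hv
    rcases hH.nonroot v a b hpv ha hb hab with h | h
    · rwa [← h]
    · rwa [← h]
  have hparent' : ∀ v ∈ K.supp, p v ∈ K.supp := by
    intro v hv
    by_cases hpv : p v = v
    · rwa [hpv]
    · exact hclosed v _ hv (hparent v hv hpv)
  -- With all degrees at least two, every non-root of `K` is joined in `H` to its parent. A deepest
  -- vertex `x` also has a back edge to an ancestor `y`, and the tree path from `x` up to `y` lies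
  -- in `H`, entering `y` through its child `q`.
  obtain ⟨x, hx, hmax⟩ := Set.exists_max_image K.supp d (Set.toFinite _) K.nonempty_supp
  have hlt : ∀ y, H.Adj x y → d y < d x := fun y hy =>
    lt_of_le_of_ne (hmax y (hclosed x y hx hy)) (hF.depth_ne (hH.le hy)).symm
  obtain ⟨y, hxy, hyp⟩ : ∃ y, H.Adj x y ∧ y ≠ p x := by
    obtain ⟨a, b, ha, hb, hab⟩ := hcon x hx
    by_cases h : a = p x
    · exact ⟨b, hb, fun h' => hab (h.trans h'.symm)⟩
    · exact ⟨a, ha, h⟩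
  have hd := hlt y hxy
  obtain ⟨-, hq, hqd⟩ := hF.child_of_lt (hH.le hxy.symm) hd
  have hqK : ∀ k, p^[k] x ∈ K.supp := by
    intro k
    induction k with
    | zero => exact hx
    | succ k ih =>
      rw [Function.iterate_succ_apply']
      exact hparent' _ ih
  specialize hqK (d x - d y - 1)
  set q := p^[d x - d y - 1] x with hqdef
  have hqne : p q ≠ q := by
    intro h
    rw [hq] at h
    rw [h] at hqd
    omega
  have hyq : H.Adj y q := by
    have := hparent q hqK hqne
    rw [hq] at this
    exact this.symm
  have hxq : x ≠ q := by
    intro h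
    rw [← h] at hq
    exact hyp hq.symm
  -- At a root `y`, the edges to `x` and `q` both avoid `f y`, so `x` is the only back neighbour of
  -- `y`; `root_back` then forces `f y = q`. At a non-root, neither `x` nor `q` is the parent of
  -- `y`.
  by_cases hy : p y = y
  · have h1 := hH.root y x q hy hxy.symm hyq hxq
    have h2 := hH.root y q x hy hyq hxy.symm hxq.symm
    obtain ⟨x', hx', hpx', hfx'⟩ := hA.root_back y x hy (hH.le hxy.symm) hyp.symm
    obtain ⟨hf1, hf2⟩ := hA.root_adj y hy
    rcases hG.eq_or_eq_or_eq (hH.le hxy.symm) (hH.le hyq) hf1 hxq h1 h2 hx' with h | h | h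
    · subst h
      rw [hF.root y hy, Nat.sub_zero] at hqdef
      exact h2 (hqdef.trans hfx')
    · exact hpx' (h ▸ hq)
    · exact hpx' (h ▸ hf2)
  · have h1 := hF.depth y hy
    rcases hH.nonroot y x q hy hxy.symm hyq hxq with h | h
    · rw [← h] at h1; omega
    · rw [← h] at h1; omega

lemma exists_iso_pathGraph (hH : IsTame G p f H) (hG : G.IsRegularOfDegree 3)
    (hF : IsNormalForest G p d) (hA : IsAdapted G p d E f) (K : H.ConnectedComponent) :
    ∃ t : ℕ, Nonempty (K.toSimpleGraph ≃g pathGraph (t + 1)) := by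
  obtain ⟨u, hu, huniq⟩ := hH.exists_degree_le_one hG hF hA K
  refine K.connected_toSimpleGraph.exists_iso_pathGraph ?_ ⟨u, hu⟩ ?_
  · rintro ⟨v, hv⟩ ⟨a, ha⟩ ⟨b, hb⟩ ⟨c, hc⟩ hva hvb hvc
    have := hH.degree_le_two hG hA v a b c hva hvb hvc
    simpa only [Subtype.mk.injEq] using this
  · rintro ⟨a, ha⟩ ⟨b, hb⟩ hua hub
    exact Subtype.ext (huniq a b hua hub)

end Component

/-- A path of `H` that starts by going to the parent keeps going to the parent. -/
lemma eq_iterate_parent (hH : IsTame G p f H) (hF : IsRootedForest G p d) {w : ℕ → V} {m : ℕ}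
    (hadj : ∀ i < m, H.Adj (w i) (w (i + 1))) (hne : ∀ i, i + 2 ≤ m → w i ≠ w (i + 2))
    (hnr : ∀ i, 0 < i → i < m → p (w i) ≠ w i) (hstart : p (w 0) = w 1) :
    ∀ i ≤ m, w i = p^[i] (w 0) := by
  have key : ∀ i < m, p (w i) = w (i + 1) := by
    intro i
    induction i with
    | zero => exact fun _ => hstart
    | succ i ih =>
      intro hi
      have hp := ih (by omega)
      have hadj1 := hadj i (by omega)
      have hn := hnr (i + 1) (by omega) hi
      rcases hH.nonroot _ _ _ hn hadj1.symm (hadj (i + 1) hi) (hne i (by omega)) with h | h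
      · have h1 := hF.depth _ hn
        have h2 := hF.depth (w i) (by rw [hp]; exact hadj1.symm.ne)
        rw [← h] at h1
        rw [hp] at h2
        omega
      · exact h.symm
  intro i
  induction i with
  | zero => exact fun _ => rfl
  | succ i ih =>
    intro hi
    rw [Function.iterate_succ_apply', ← ih (by omega), key i (by omega)]

/-- If no path of `l` edges of `H` leads from a vertex upwards in the forest, then a path of `H`
whose inner vertices are not roots has fewer than `2 * l` edges. -/
lemma segment_lt (hH : IsTame G p f H) (hF : IsRootedForest G p d) {l : ℕ} (hl : 0 < l)
    (hup : ∀ v, ¬ ∀ i < l, H.Adj (p^[i] v) (p^[i + 1] v)) {w : ℕ → V} {m : ℕ}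
    (hadj : ∀ i < m, H.Adj (w i) (w (i + 1))) (hne : ∀ i, i + 2 ≤ m → w i ≠ w (i + 2))
    (hnr : ∀ i, 0 < i → i < m → p (w i) ≠ w i) : m < 2 * l := by
  by_contra! hm
  have main : ∀ (w' : ℕ → V) (m' : ℕ), l ≤ m' → (∀ i < m', H.Adj (w' i) (w' (i + 1))) →
      (∀ i, i + 2 ≤ m' → w' i ≠ w' (i + 2)) →
      (∀ i, 0 < i → i < m' → p (w' i) ≠ w' i) → p (w' 0) ≠ w' 1 := by
    intro w' m' hlm hadj' hne' hnr' hstart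
    have h := hH.eq_iterate_parent hF hadj' hne' hnr' hstart
    refine hup (w' 0) fun i hi => ?_
    rw [← h i (by omega), ← h (i + 1) (by omega)]
    exact hadj' i (by omega)
  obtain ⟨k, rfl⟩ : ∃ k, l = k + 1 := ⟨l - 1, by omega⟩
  -- One of the two path edges at the vertex of index `l` leads to its parent. Following the path in
  -- that direction gives at least `l` upward steps, contradicting `hup`.
  rcases hH.nonroot (w (k + 1)) (w k) (w (k + 1 + 1)) (hnr _ hl (by omega))
    (hadj k (by omega)).symm (hadj (k + 1) (by omega)) (hne k (by omega)) with h | h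
  · refine main (fun i => w (k + 1 - i)) (k + 1) le_rfl ?_ ?_ ?_ ?_
    · intro i hi
      have := (hadj (k - i) (by omega)).symm
      rwa [show k - i + 1 = k + 1 - i by omega, show k - i = k + 1 - (i + 1) by omega] at this
    · intro i hi
      have := (hne (k + 1 - (i + 2)) (by omega)).symm
      rwa [show k + 1 - (i + 2) + 2 = k + 1 - i by omega] at this
    · intro i h0 hi
      exact hnr _ (by omega) (by omega)
    · simpa using h.symm
  · refine main (fun i => w (k + 1 + i)) (m - (k + 1)) (by omega) ?_ ?_ ?_ ?_
    · intro i hi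
      exact hadj _ (by omega)
    · intro i hi
      exact hne _ (by omega)
    · intro i h0 hi
      exact hnr _ (by omega) (by omega)
    · simpa using h.symm

/-- Edges of `G` stay inside one tree, so the path meets at most one root; cutting there leaves two
pieces to which `segment_lt` applies. -/
lemma path_length_lt (hH : IsTame G p f H) (hF : IsNormalForest G p d) {l : ℕ} (hl : 0 < l)
    (hup : ∀ v, ¬ ∀ i < l, H.Adj (p^[i] v) (p^[i + 1] v)) {w : ℕ → V} {t : ℕ}
    (hadj : ∀ i < t, H.Adj (w i) (w (i + 1)))
    (hinj : ∀ i j, i ≤ t → j ≤ t → w i = w j → i = j) : t < 4 * l := by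
  have hroot : ∀ i ≤ t, p^[d (w i)] (w i) = p^[d (w 0)] (w 0) := by
    intro i
    induction i with
    | zero => exact fun _ => rfl
    | succ i ih =>
      intro hi
      rw [← ih (by omega), hF.root_eq_of_adj (hH.le (hadj i (by omega)))]
  have huniq : ∀ i j, i ≤ t → j ≤ t → p (w i) = w i → p (w j) = w j → i = j := by
    intro i j hi hj hpi hpj
    apply hinj i j hi hj
    have h1 := hroot i hi
    have h2 := hroot j hj
    rw [hF.root _ hpi] at h1
    rw [hF.root _ hpj] at h2
    exact h1.trans h2.symm
  have hne : ∀ i, i + 2 ≤ t → w i ≠ w (i + 2) := by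
    intro i hi h
    have := hinj i (i + 2) (by omega) hi h
    omega
  by_cases hex : ∃ j ≤ t, p (w j) = w j
  · obtain ⟨j, hj, hpj⟩ := hex
    have h1 : j < 2 * l := hH.segment_lt hF.toIsRootedForest hl hup
      (fun i hi => hadj i (by omega)) (fun i hi => hne i (by omega))
      (fun i h0 hi hp => by have := huniq i j (by omega) hj hp hpj; omega)
    have h2 : t - j < 2 * l := hH.segment_lt (w := fun i => w (j + i)) hF.toIsRootedForest hl hup
      (fun i hi => hadj _ (by omega)) (fun i hi => hne _ (by omega))
      (fun i h0 hi hp => by have := huniq (j + i) j (by omega) hj hp hpj; omega)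
    omega
  · push Not at hex
    have := hH.segment_lt hF.toIsRootedForest hl hup hadj hne (fun i _ hi => hex i hi.le)
    omega

lemma component_length_lt (hH : IsTame G p f H) (hF : IsNormalForest G p d) {l : ℕ}
    (hl : 0 < l) (hup : ∀ v, ¬ ∀ i < l, H.Adj (p^[i] v) (p^[i + 1] v))
    {K : H.ConnectedComponent} {t : ℕ} (e : K.toSimpleGraph ≃g pathGraph (t + 1)) :
    t < 4 * l := by
  have hlt : ∀ i, min i t < t + 1 := fun i => by omega
  refine hH.path_length_lt (w := fun i => (e.symm ⟨min i t, hlt i⟩).val) hF hl hup ?_ ?_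
  · intro i hi
    have : (pathGraph (t + 1)).Adj ⟨min i t, hlt i⟩ ⟨min (i + 1) t, hlt (i + 1)⟩ := by
      rw [pathGraph_adj]
      left
      simp only
      omega
    exact e.symm.map_adj_iff.2 this
  · intro i j hi hj hij
    have := e.symm.injective (Subtype.ext hij)
    rw [Fin.mk.injEq] at this
    omega

end IsTame

/-! ### Random bits: locality, symmetry and the union bound. -/

open SimpleGraph

section Locality

variable {V : Type*} [Fintype V] [DecidableEq V] {G : SimpleGraph V} [DecidableRel G.Adj]

/-- The vertices from which `u` is reached by at most three steps. -/
def ballThree (G : SimpleGraph V) [DecidableRel G.Adj] (u : V) : Finset V :=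
  (insert u (G.neighborFinset u)).biUnion fun c =>
    (insert c (G.neighborFinset c)).biUnion fun a => insert a (G.neighborFinset a)

lemma card_ballThree_le (hG : G.IsRegularOfDegree 3) (u : V) : (ballThree G u).card ≤ 64 := by
  have h1 : ∀ v, (insert v (G.neighborFinset v)).card ≤ 4 := fun v =>
    (Finset.card_insert_le _ _).trans (Nat.succ_le_succ (hG v).le)
  have h2 : ∀ c, ((insert c (G.neighborFinset c)).biUnion
      fun a => insert a (G.neighborFinset a)).card ≤ 16 := fun c =>
    (Finset.card_biUnion_le_card_mul _ _ 4 fun a _ => h1 a).trans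
      (Nat.mul_le_mul_right 4 (h1 c))
  exact (Finset.card_biUnion_le_card_mul _ _ 16 fun c _ => h2 c).trans
    (Nat.mul_le_mul_right 16 (h1 u))

lemma WithinThree.mem_ballThree {x u : V} (h : WithinThree G x u) : x ∈ ballThree G u := by
  obtain ⟨a, c, hxa, hac, hcu⟩ := h
  simp only [ballThree, Finset.mem_biUnion, Finset.mem_insert, mem_neighborFinset]
  exact ⟨c, hcu.imp id fun h => h.symm, a, hac.imp id fun h => h.symm,
    hxa.imp id fun h => h.symm⟩

end Locality

section Colouring

variable {V : Type*} {G : SimpleGraph V} {p f : V → V} {d : V → ℕ} {E : V → V → Bool × V}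

lemma signedColour_not (E : V → V → Bool × V) (b : V → Bool) (x y : V) :
    signedColour E (fun v => !b v) x y = !signedColour E b x y := by
  simp [signedColour]

/-- The subgraph of the edges of colour `c`. -/
def colourGraph (G : SimpleGraph V) (E : V → V → Bool × V) (b : V → Bool) (c : Bool) :
    SimpleGraph V :=
  SimpleGraph.fromRel fun x y => G.Adj x y ∧ signedColour E b x y = c

lemma IsAdapted.colourGraph_adj (hA : IsAdapted G p d E f) (b : V → Bool) (c : Bool) (x y : V) :
    (colourGraph G E b c).Adj x y ↔ G.Adj x y ∧ signedColour E b x y = c := by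
  rw [colourGraph, SimpleGraph.fromRel_adj]
  constructor
  · rintro ⟨-, h | ⟨h1, h2⟩⟩
    · exact h
    · refine ⟨h1.symm, ?_⟩
      rwa [signedColour, hA.symm x y h1.symm]
  · exact fun h => ⟨h.1.ne, .inl h⟩

lemma IsAdapted.colourGraph_not (hA : IsAdapted G p d E f) (b : V → Bool) (c : Bool) :
    colourGraph G E (fun v => !b v) c = colourGraph G E b (!c) := by
  ext x y
  rw [hA.colourGraph_adj, hA.colourGraph_adj, signedColour_not]
  cases signedColour E b x y <;> cases c <;> simp

/-- The difference between the numbers of components of the two colours that are paths with `t`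
edges. -/
noncomputable def pathDiff (G : SimpleGraph V) (E : V → V → Bool × V) (t : ℕ) (b : V → Bool) :
    ℝ :=
  (colourGraph G E b true).numPathComponents t - (colourGraph G E b false).numPathComponents t

variable [Fintype V] [DecidableEq V]

/-- Complementing every bit exchanges the two colours and negates the difference. -/
lemma IsAdapted.sum_pathDiff (hA : IsAdapted G p d E f) (t : ℕ) :
    ∑ b, pathDiff G E t b = 0 := by
  have hinv : Function.Involutive fun (b : V → Bool) v => !b v := fun b => by simp
  have h1 : ∑ b : V → Bool, pathDiff G E t (fun v => !b v) = ∑ b, pathDiff G E t b :=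
    Equiv.sum_comp hinv.toPerm (pathDiff G E t)
  have h2 : ∀ b : V → Bool, pathDiff G E t (fun v => !b v) = -pathDiff G E t b := by
    intro b
    rw [pathDiff, pathDiff, hA.colourGraph_not, hA.colourGraph_not, Bool.not_true,
      Bool.not_false]
    ring
  simp only [h2, Finset.sum_neg_distrib] at h1
  linarith

variable [DecidableRel G.Adj]

/-- Only edges labelled by `u` change colour, and their ends lie in `ballThree G u`, which has at
most `4 ^ 3 = 64` vertices. -/
lemma IsAdapted.numPathComponents_flipBit_le (hA : IsAdapted G p d E f)
    (hG : G.IsRegularOfDegree 3) (t : ℕ) (b : V → Bool) (u : V) (c : Bool) :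
    |((colourGraph G E (flipBit u b) c).numPathComponents t : ℝ) -
      (colourGraph G E b c).numPathComponents t| ≤ 64 := by
  have hagree : ∀ x y, x ∉ ballThree G u →
      ((colourGraph G E (flipBit u b) c).Adj x y ↔ (colourGraph G E b c).Adj x y) := by
    intro x y hx
    rw [hA.colourGraph_adj, hA.colourGraph_adj]
    refine and_congr_right fun hxy => ?_
    have hne : (E x y).2 ≠ u := by
      rintro rfl
      exact hx (hA.local_label x y hxy).mem_ballThree
    rw [signedColour, signedColour, flipBit_of_ne b hne]
  have hcard := card_ballThree_le hG u
  have h1 := numPathComponents_le_of_agree hagree t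
  have h2 := numPathComponents_le_of_agree (fun x y hx => (hagree x y hx).symm) t
  rw [abs_le]
  constructor
  · have : (colourGraph G E b c).numPathComponents t ≤
        (colourGraph G E (flipBit u b) c).numPathComponents t + 64 := by omega
    have : ((colourGraph G E b c).numPathComponents t : ℝ) ≤
        (colourGraph G E (flipBit u b) c).numPathComponents t + 64 := by exact_mod_cast this
    linarith
  · have : (colourGraph G E (flipBit u b) c).numPathComponents t ≤
        (colourGraph G E b c).numPathComponents t + 64 := by omega
    have : ((colourGraph G E (flipBit u b) c).numPathComponents t : ℝ) ≤
        (colourGraph G E b c).numPathComponents t + 64 := by exact_mod_cast this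
    linarith

lemma IsAdapted.pathDiff_flipBit_le (hA : IsAdapted G p d E f) (hG : G.IsRegularOfDegree 3)
    (t : ℕ) (b : V → Bool) (u : V) :
    |pathDiff G E t (flipBit u b) - pathDiff G E t b| ≤ 128 := by
  have h1 := abs_le.1 (hA.numPathComponents_flipBit_le hG t b u true)
  have h2 := abs_le.1 (hA.numPathComponents_flipBit_le hG t b u false)
  rw [pathDiff, pathDiff, abs_le]
  constructor <;> linarith [h1.1, h1.2, h2.1, h2.2]

/-- Chebyshev's inequality for the difference between the two colours, with `n = y ^ 3`. -/
lemma IsAdapted.card_pathDiff_gt_mul_le (hA : IsAdapted G p d E f) (hG : G.IsRegularOfDegree 3)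
    (t : ℕ) {y : ℝ} (hy : 0 < y) (hyn : y ^ 3 = Fintype.card V) :
    ((Finset.univ.filter fun b : V → Bool => y ^ 2 < |pathDiff G E t b|).card : ℝ) * y ≤
      2 ^ Fintype.card V * 128 ^ 2 := by
  have h := sum_sq_le_of_flipBit_lipschitz (pathDiff G E t) 128
    (hA.pathDiff_flipBit_le hG t) (hA.sum_pathDiff t)
  set B := Finset.univ.filter fun b : V → Bool => y ^ 2 < |pathDiff G E t b| with hB
  -- The squared threshold is `y ^ 4` against a variance of order `n = y ^ 3`, which leaves the
  -- factor `y`.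
  have h1 : (B.card : ℝ) * y ^ 4 ≤ ∑ b, pathDiff G E t b ^ 2 := by
    calc (B.card : ℝ) * y ^ 4 = ∑ _b ∈ B, y ^ 4 := by simp
      _ ≤ ∑ b ∈ B, pathDiff G E t b ^ 2 := by
        refine Finset.sum_le_sum fun b hb => ?_
        have hb' : y ^ 2 < |pathDiff G E t b| := (Finset.mem_filter.1 hb).2
        rw [← sq_abs (pathDiff G E t b)]
        calc y ^ 4 = (y ^ 2) ^ 2 := by ring
          _ ≤ _ := by gcongr
      _ ≤ _ := Finset.sum_le_sum_of_subset_of_nonneg (Finset.subset_univ _)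
        fun b _ _ => sq_nonneg _
  rw [← hyn] at h
  have hy3 : 0 < y ^ 3 := by positivity
  refine le_of_mul_le_mul_left ?_ hy3
  calc y ^ 3 * (B.card * y) = B.card * y ^ 4 := by ring
    _ ≤ _ := h1.trans h

/-- A monochromatic path with `64 * m` edges leading upwards from `v` is unlikely. -/
lemma IsAdapted.card_upward_mul_le (hA : IsAdapted G p d E f) (hG : G.IsRegularOfDegree 3)
    (hF : IsRootedForest G p d) (v : V) (c : Bool) (m : ℕ) :
    (Finset.univ.filter fun b : V → Bool =>
      ∀ i < 64 * m, G.Adj (p^[i] v) (p^[i + 1] v) ∧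
        signedColour E b (p^[i] v) (p^[i + 1] v) = c).card * 2 ^ m ≤ 2 ^ Fintype.card V := by
  set B := Finset.univ.filter fun b : V → Bool =>
    ∀ i < 64 * m, G.Adj (p^[i] v) (p^[i + 1] v) ∧
      signedColour E b (p^[i] v) (p^[i + 1] v) = c
  by_cases hchain : ∀ i < 64 * m, G.Adj (p^[i] v) (p^[i + 1] v)
  swap
  · have : B = ∅ := by
      rw [Finset.eq_empty_iff_forall_notMem]
      intro b hb
      exact hchain fun i hi => ((Finset.mem_filter.1 hb).2 i hi).1
    simp [this]
  set lab : ℕ → V := fun i => (E (p^[i] v) (p^[i + 1] v)).2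
  set L := (Finset.range (64 * m)).image lab
  -- Edges with a common label `u` start at distinct vertices of `ballThree G u`, so a bit serves at
  -- most 64 of them. The starting vertices are distinct because their depths strictly decrease.
  have hL : m ≤ L.card := by
    have : (Finset.range (64 * m)).card ≤ 64 * L.card := by
      refine Finset.card_le_mul_card_image _ 64 fun u _ => ?_
      refine le_trans ?_ (card_ballThree_le hG u)
      refine Finset.card_le_card_of_injOn (fun i => p^[i] v) ?_ ?_
      · intro i hi
        simp only [Finset.coe_filter, Set.mem_ofPred_eq, Finset.mem_range] at hi
        obtain ⟨hi, rfl⟩ := hi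
        exact (hA.local_label _ _ (hchain i hi)).mem_ballThree
      · have hdep : ∀ i < 64 * m, i < d v := by
          intro i hi
          by_contra! hdi
          have h1 := hF.depth_iterate v i
          have h2 := (hF.root_iff (p^[i] v)).2 (by omega)
          have h3 := (hchain i hi).ne
          rw [Function.iterate_succ_apply', h2] at h3
          exact h3 rfl
        intro i hi j hj hij
        simp only [Finset.coe_filter, Set.mem_ofPred_eq, Finset.mem_range] at hi hj
        have h1 := hdep i hi.1
        have h2 := hdep j hj.1
        have h3 := hF.depth_iterate v i
        have h4 := hF.depth_iterate v j
        simp only at hij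
        rw [hij] at h3
        omega
    rw [Finset.card_range] at this
    omega
  have hidx : ∀ u, ∃ i, u ∈ L → i < 64 * m ∧ lab i = u := by
    intro u
    by_cases hu : u ∈ L
    · obtain ⟨i, hi, hiu⟩ := Finset.mem_image.1 hu
      exact ⟨i, fun _ => ⟨Finset.mem_range.1 hi, hiu⟩⟩
    · exact ⟨0, fun h => absurd h hu⟩
  choose g hg using hidx
  -- One edge for each label in `L` already determines the bit at that label.
  have hsub : B ⊆ Finset.univ.filter fun b : V → Bool =>
      ∀ u ∈ L, b u = xor (E (p^[g u] v) (p^[g u + 1] v)).1 c := by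
    intro b hb
    rw [Finset.mem_filter]
    refine ⟨Finset.mem_univ _, fun u hu => ?_⟩
    obtain ⟨hi, hlab⟩ := hg u hu
    have hcol := ((Finset.mem_filter.1 hb).2 (g u) hi).2
    rw [signedColour] at hcol
    change xor _ (b (lab (g u))) = c at hcol
    rw [hlab] at hcol
    rw [← hcol]
    simp
  calc B.card * 2 ^ m ≤ _ * 2 ^ L.card :=
        Nat.mul_le_mul (Finset.card_le_card hsub) (Nat.pow_le_pow_right (by norm_num) hL)
    _ = _ := card_filter_eq_on L _

/-- Some choice of the bits avoids all the unlikely events. -/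
lemma IsAdapted.exists_bits (hA : IsAdapted G p d E f) (hG : G.IsRegularOfDegree 3)
    (hF : IsRootedForest G p d) {m T : ℕ} {y : ℝ} (hy : 0 < y)
    (hyn : y ^ 3 = Fintype.card V) (hm : 8 * Fintype.card V ≤ 2 ^ m)
    (hT : (T : ℝ) * (2 * 128 ^ 2) ≤ y) :
    ∃ b : V → Bool,
      (∀ v c, ¬ ∀ i < 64 * m, (colourGraph G E b c).Adj (p^[i] v) (p^[i + 1] v)) ∧
      ∀ t < T, |pathDiff G E t b| ≤ y ^ 2 := by
  set n := Fintype.card V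
  let U : V × Bool → Finset (V → Bool) := fun q => Finset.univ.filter fun b =>
    ∀ i < 64 * m, G.Adj (p^[i] q.1) (p^[i + 1] q.1) ∧
      signedColour E b (p^[i] q.1) (p^[i + 1] q.1) = q.2
  let B : ℕ → Finset (V → Bool) := fun t =>
    Finset.univ.filter fun b => y ^ 2 < |pathDiff G E t b|
  set W := Finset.univ.biUnion U ∪ (Finset.range T).biUnion B with hW
  have hpos : (0 : ℝ) < 2 ^ n := by positivity
  -- There are `2 * n` pairs of a vertex and a colour, each of probability at most `1 / (8 * n)`.
  have hU : ((Finset.univ.biUnion U).card : ℝ) ≤ 2 ^ n / 4 := by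
    have h1 : (Finset.univ.biUnion U).card * 2 ^ m ≤ 2 * n * 2 ^ n := by
      calc (Finset.univ.biUnion U).card * 2 ^ m ≤ (∑ q, (U q).card) * 2 ^ m :=
            Nat.mul_le_mul_right _ Finset.card_biUnion_le
        _ = ∑ q, (U q).card * 2 ^ m := Finset.sum_mul _ _ _
        _ ≤ ∑ _q : V × Bool, 2 ^ n :=
            Finset.sum_le_sum fun q _ => hA.card_upward_mul_le hG hF q.1 q.2 m
        _ = 2 * n * 2 ^ n := by simp [n]; ring
    have h2 : (Finset.univ.biUnion U).card * (8 * n) ≤ 2 * n * 2 ^ n :=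
      (Nat.mul_le_mul_left _ hm).trans h1
    have hn : (0 : ℝ) < n := by rw [← hyn]; positivity
    have h3 : ((Finset.univ.biUnion U).card : ℝ) * (8 * n) ≤ 2 * n * 2 ^ n := by
      exact_mod_cast h2
    have h4 : (2 * n : ℝ) * ((Finset.univ.biUnion U).card * 4) ≤ (2 * n) * 2 ^ n := by
      linarith
    have := le_of_mul_le_mul_left h4 (by positivity)
    linarith
  -- Each of the `T` lengths fails with probability at most `128 ^ 2 / y`; `hT` makes the sum at
  -- most one half.
  have hB : (((Finset.range T).biUnion B).card : ℝ) ≤ 2 ^ n / 2 := by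
    have h1 : (((Finset.range T).biUnion B).card : ℝ) * y ≤ T * (2 ^ n * 128 ^ 2) := by
      calc (((Finset.range T).biUnion B).card : ℝ) * y
          ≤ (∑ t ∈ Finset.range T, ((B t).card : ℝ)) * y := by
            gcongr
            exact_mod_cast Finset.card_biUnion_le
        _ = ∑ t ∈ Finset.range T, ((B t).card : ℝ) * y := Finset.sum_mul _ _ _
        _ ≤ ∑ _t ∈ Finset.range T, (2 ^ n * 128 ^ 2 : ℝ) :=
            Finset.sum_le_sum fun t _ => hA.card_pathDiff_gt_mul_le hG t hy hyn
        _ = _ := by simp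
    have h2 := mul_le_mul_of_nonneg_left hT hpos.le
    have h3 : (((Finset.range T).biUnion B).card : ℝ) * y ≤ 2 ^ n / 2 * y := by linarith
    exact le_of_mul_le_mul_right h3 hy
  have hlt : W.card < (Finset.univ : Finset (V → Bool)).card := by
    have h1 : (W.card : ℝ) ≤
        (Finset.univ.biUnion U).card + ((Finset.range T).biUnion B).card := by
      exact_mod_cast Finset.card_union_le _ _
    have h2 : (W.card : ℝ) < 2 ^ n := by linarith
    have h3 : (Finset.univ : Finset (V → Bool)).card = 2 ^ n := by simp [n]
    rw [h3]
    exact_mod_cast h2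
  obtain ⟨b, -, hb⟩ := Finset.exists_mem_notMem_of_card_lt_card hlt
  simp only [hW, Finset.mem_union, Finset.mem_biUnion, not_or, not_exists, not_and] at hb
  refine ⟨b, fun v c hup => ?_, fun t ht => ?_⟩
  · refine hb.1 (v, c) (Finset.mem_univ _) (Finset.mem_filter.2 ⟨Finset.mem_univ _, ?_⟩)
    exact fun i hi => (hA.colourGraph_adj b c _ _).1 (hup i hi)
  · by_contra! hcon
    exact hb.2 t (Finset.mem_range.2 ht) (Finset.mem_filter.2 ⟨Finset.mem_univ _, hcon⟩)

end Colouring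

/-! ### Choice of constants and assembly. -/

lemma exists_labeling_labelGraph_eq {V : Type*} {G : SimpleGraph V} {p f : V → V} {d : V → ℕ}
    {E : V → V → Bool × V} (hA : IsAdapted G p d E f) (b : V → Bool) :
    ∃ χ : G.EdgeLabeling EdgeColour,
      χ.labelGraph EdgeColour.red = colourGraph G E b true ∧
      χ.labelGraph EdgeColour.blue = colourGraph G E b false := by
  refine ⟨EdgeLabeling.mk
    (fun x y _ => if signedColour E b x y then EdgeColour.red else EdgeColour.blue) ?_, ?_, ?_⟩
  · intro x y hxy
    have : signedColour E b y x = signedColour E b x y := by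
      rw [signedColour, signedColour, hA.symm x y hxy]
    rw [this]
  all_goals
    ext x y
    rw [EdgeLabeling.labelGraph_adj, hA.colourGraph_adj]
    simp only [← EdgeLabeling.get_eq, EdgeLabeling.get_mk, exists_prop]
    refine and_congr_right fun _ => ?_
    cases signedColour E b x y <;> simp

lemma numPathComponents_eq_zero {V : Type*} {H : SimpleGraph V} {t : ℕ}
    (h : ∀ K : H.ConnectedComponent, ¬ Nonempty (K.toSimpleGraph ≃g pathGraph (t + 1))) :
    H.numPathComponents t = 0 := by
  have : {K : H.ConnectedComponent | Nonempty (K.toSimpleGraph ≃g pathGraph (t + 1))} = ∅ :=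
    Set.eq_empty_iff_forall_notMem.2 h
  rw [numPathComponents, this, Set.ncard_empty]

lemma eventually_log_mul_le :
    ∃ N : ℕ, 3 ≤ N ∧ ∀ n : ℕ, N ≤ n →
      1536 * Real.log n * (2 * 128 ^ 2) ≤ (n : ℝ) ^ ((1 : ℝ) / 3) := by
  have h := (isLittleO_log_rpow_atTop (r := (1 : ℝ) / 3) (by norm_num)).bound
    (show (0 : ℝ) < 1 / (1536 * (2 * 128 ^ 2)) by norm_num)
  obtain ⟨N, hN⟩ := Filter.eventually_atTop.1
    (tendsto_natCast_atTop_atTop.eventually h)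
  refine ⟨max N 3, le_max_right _ _, fun n hn => ?_⟩
  have h1 := hN n ((le_max_left _ _).trans hn)
  rw [Real.norm_eq_abs, Real.norm_eq_abs, abs_of_nonneg (Real.log_natCast_nonneg n),
    abs_of_nonneg (by positivity)] at h1
  rw [div_mul_eq_mul_div, le_div_iff₀ (by norm_num)] at h1
  linarith

theorem theorem1p5 :
    ∃ (C : ℝ) (N : ℕ), ∀ (V : Type*) [Fintype V] (G : SimpleGraph V) [DecidableRel G.Adj],
      G.IsRegularOfDegree 3 → N ≤ Fintype.card V →
      ∃ χ : G.EdgeLabeling EdgeColour,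
        (∀ (c : EdgeColour) (K : EdgeColour.MonoComponent χ c),
          ∃ t : ℕ, EdgeColour.IsPathOfLength K t ∧
            (t : ℝ) ≤ C * Real.log (Fintype.card V)) ∧
        ∀ t : ℕ, 1 ≤ t →
          |(EdgeColour.numPaths χ EdgeColour.red t : ℝ) -
              (EdgeColour.numPaths χ EdgeColour.blue t : ℝ)| ≤
            (Fintype.card V : ℝ) ^ ((2 : ℝ) / 3) := by
  obtain ⟨N, hN3, hN⟩ := eventually_log_mul_le
  refine ⟨1536, N, fun V _ G _ hG hcard => ?_⟩
  classical
  obtain ⟨p, d, hF⟩ := exists_isNormalForest G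
  obtain ⟨E, f, hA⟩ := hF.exists_isAdapted hG
  set n := Fintype.card V with hn
  have hlog1 : 1 ≤ Real.log n := by
    rw [Real.le_log_iff_exp_le (by have : 0 < n := by omega
                                   exact_mod_cast this)]
    have : (3 : ℝ) ≤ n := by exact_mod_cast hN3.trans hcard
    linarith [Real.exp_one_lt_d9]
  -- This gives `8 * n ≤ 2 ^ m`, and `m ≤ 6 * log n` because `log n ≥ 1` absorbs the 4. Paths are
  -- shorter than `4 * (64 * m)`, whence `1536 = 4 * 64 * 6`.
  set m := Nat.log 2 n + 4 with hm
  have hmlog : (m : ℝ) ≤ 6 * Real.log n := by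
    have h1 : (Nat.log 2 n : ℝ) ≤ Real.logb 2 n := Real.natLog_le_logb n 2
    have h2 : Real.logb 2 n ≤ 2 * Real.log n := by
      rw [Real.logb, div_le_iff₀ (Real.log_pos (by norm_num))]
      nlinarith [Real.log_two_gt_d9]
    push_cast [hm]
    linarith
  have hm8 : 8 * n ≤ 2 ^ m := by
    have := Nat.lt_pow_succ_log_self (b := 2) (by norm_num) n
    rw [hm, show Nat.log 2 n + 4 = (Nat.log 2 n).succ + 3 by rfl, pow_add]
    omega
  have hT : ((4 * (64 * m) : ℕ) : ℝ) ≤ 1536 * Real.log n := by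
    push_cast
    linarith
  have hn0 : (0 : ℝ) < n := by
    have : 0 < n := by omega
    exact_mod_cast this
  set y : ℝ := (n : ℝ) ^ ((1 : ℝ) / 3) with hy
  have hy0 : 0 < y := by positivity
  have hy3 : y ^ 3 = n := by
    rw [hy, ← Real.rpow_natCast, ← Real.rpow_mul hn0.le]
    norm_num
  have hy2 : y ^ 2 = (n : ℝ) ^ ((2 : ℝ) / 3) := by
    rw [hy, ← Real.rpow_natCast, ← Real.rpow_mul hn0.le]
    norm_num
  obtain ⟨b, hup, hdiff⟩ := hA.exists_bits hG hF.toIsRootedForest (T := 4 * (64 * m)) hy0 hy3 hm8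
    (le_trans (by gcongr) (hN n hcard))
  obtain ⟨χ, hred, hblue⟩ := exists_labeling_labelGraph_eq hA b
  have hχ : ∀ c, ∃ c', χ.labelGraph c = colourGraph G E b c' := by
    rintro (_ | _)
    · exact ⟨true, hred⟩
    · exact ⟨false, hblue⟩
  have htame : ∀ c', IsTame G p f (colourGraph G E b c') := fun c' =>
    hA.isTame (hA.colourGraph_adj b c')
  have hlen : ∀ c' (K : (colourGraph G E b c').ConnectedComponent) t,
      K.toSimpleGraph ≃g pathGraph (t + 1) → t < 4 * (64 * m) := fun c' K t e =>
    (htame c').component_length_lt hF (by omega) (fun v => hup v c') e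
  refine ⟨χ, fun c => ?_, fun t _ => ?_⟩
  · obtain ⟨c', hc'⟩ := hχ c
    have main : ∀ K : (colourGraph G E b c').ConnectedComponent, ∃ t : ℕ,
        Nonempty (K.toSimpleGraph ≃g pathGraph (t + 1)) ∧ (t : ℝ) ≤ 1536 * Real.log n := by
      intro K
      obtain ⟨t, ⟨e⟩⟩ := (htame c').exists_iso_pathGraph hG hF hA K
      refine ⟨t, ⟨e⟩, le_trans ?_ hT⟩
      exact_mod_cast (hlen c' K t e).le
    rw [← hc'] at main
    exact main
  · change |((χ.labelGraph EdgeColour.red).numPathComponents t : ℝ) -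
      (χ.labelGraph EdgeColour.blue).numPathComponents t| ≤ _
    rw [hred, hblue, ← hy2]
    -- Longer paths occur in neither colour, so the union bound needed only these lengths.
    by_cases ht : t < 4 * (64 * m)
    · exact hdiff t ht
    · rw [numPathComponents_eq_zero fun K ⟨e⟩ => ht (hlen _ K t e),
        numPathComponents_eq_zero fun K ⟨e⟩ => ht (hlen _ K t e)]
      simp only [CharP.cast_eq_zero, sub_self, abs_zero]
      positivity
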